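/- Let $\mathcal G$ be a directed acyclic graph on the nodes $1,\dots,n$ and let $x_1,\dots,x_n$ be random variables (discrete, continuous or mixed) on a standard Borel probability space with joint law $P$. Assume that $\mathcal G$ represents $P$: (Markov condition) $P=\prod_i P(x_i\mid Pa_i)$, i.e. every $x_i$ is conditionally independent of its non-descendants given its parents; and (faithfulness) whenever $x_A\perp\!\!\!\perp x_B\mid x_C$ for disjoint sets of nodes $A,B,C$, the sets $A$ and $B$ are d-separated given $C$ in $\mathcal G$. The true Markov blanket $MB_i$ is the set of all parents, children and spouses (other nodes that share a child with $i$) of the node $i$ in $\mathcal G$. Let $I(x_i;x_j\mid Z)\in[0,\infty]$ be the computed conditional mutual information, and consider the following algorithm (improved IAMB) with threshold $\alpha$. 1. For $i=1,\dots,n$: (forward phase) start with $CMB_i=\emptyset$ and $S=\{1,\dots,n\}$; repeatedly find a $j\in S$, $j\ne i$, that maximizes $I(x_i;x_j\mid CMB_i)$; if this maximum is $>\alpha$, add $j$ to $CMB_i$ and remove it from $S$, otherwise (or if no such $j$ is left) stop; (backward phase) for each $k\in CMB_i$ in turn, remove $k$ from $CMB_i$ if $I(x_i;x_k\mid CMB_i\setminus\{k\})<\alpha$,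 where $CMB_i$ is the current set. 2. (symmetry check) For $i=1,\dots,n$ and each $j\in CMB_i$ in turn, remove $j$ from $CMB_i$ if $i\notin CMB_j$. 3. Return $CMB_1,\dots,CMB_n$. Suppose that for all nodes $i\neq j$ and all sets $Z$ of nodes with $i,j\notin Z$ one has $I(x_i;x_j\mid Z)=0$ if and only if $x_i\perp\!\!\!\perp x_j\mid Z$. Then there is $\alpha_0>0$ such that for every $\alpha$ with $0<\alpha<\alpha_0$, however ties are broken and in whatever order the loops over the elements of the sets $CMB_i$ are run, the algorithm returns $CMB_i=MB_i$ for all $i$. -/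

import Mathlib

open MeasureTheory ProbabilityTheory

namespace ImprovedIAMB

/-! ## Directed acyclic graphs, Markov blankets, d-separation -/

section Graph

variable {V : Type*}

/-- A directed graph is acyclic if no directed path of positive length returns to its start. -/
def IsDAG (G : Digraph V) : Prop :=
  ∀ v, ¬ Relation.TransGen G.Adj v v

/-- The parents of `v`. -/
def parents (G : Digraph V) (v : V) : Set V := {u | G.Adj u v}

/-- The children of `v`. -/
def children (G : Digraph V) (v : V) : Set V := {u | G.Adj v u}

/-- The spouses of `v`: the other nodes that have a child in common with `v`. -/
def spouses (G : Digraph V) (v : V) : Set V := {u | u ≠ v ∧ ∃ c, G.Adj v c ∧ G.Adj u c}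

/-- The Markov blanket of `v`: its parents, its children and its spouses. -/
def markovBlanket (G : Digraph V) (v : V) : Set V :=
  parents G v ∪ children G v ∪ spouses G v

/-- The nodes other than `v` that are not reachable from `v` by a directed path. -/
def nonDescendants (G : Digraph V) (v : V) : Set V := {u | ¬ Relation.ReflTransGen G.Adj v u}

/-- `x 0, …, x L` is a trail: consecutive nodes are joined by an edge, in either direction.
Nodes may be repeated. -/
def IsTrail (G : Digraph V) (L : ℕ) (x : ℕ → V) : Prop :=
  ∀ k < L, G.Adj (x k) (x (k + 1)) ∨ G.Adj (x (k + 1)) (x k)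

/-- The trail `x 0, …, x L` has a collider at position `k`, that is, an interior position with
`x (k - 1) → x k ← x (k + 1)`. -/
def IsCollider (G : Digraph V) (L : ℕ) (x : ℕ → V) (k : ℕ) : Prop :=
  0 < k ∧ k < L ∧ G.Adj (x (k - 1)) (x k) ∧ G.Adj (x (k + 1)) (x k)

/-- A trail is active given `Z` if all its colliders belong to `Z` and none of its other nodes
belongs to `Z`. As trails may repeat nodes, the existence of such a trail between two nodes
outside `Z` is the same as the existence of a trail without repeated nodes on which every collider
is in `Z` or has a descendant in `Z` and no other node is in `Z` (walk down from the collider to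
the descendant and back up again). -/
def IsActive (G : Digraph V) (Z : Set V) (L : ℕ) (x : ℕ → V) : Prop :=
  ∀ k ≤ L, (IsCollider G L x k → x k ∈ Z) ∧ (¬ IsCollider G L x k → x k ∉ Z)

/-- `A` and `B` are d-separated given `C`: no trail from `A` to `B` is active given `C`. -/
def DSep (G : Digraph V) (A B C : Set V) : Prop :=
  ∀ (L : ℕ) (x : ℕ → V), x 0 ∈ A → x L ∈ B → IsTrail G L x → ¬ IsActive G C L x

end Graph

/-! ## Conditional independence of families of random variables -/

section Probability

variable {V Ω : Type*} {E : V → Type*} [∀ v, MeasurableSpace (E v)]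

/-- The σ-algebra on `Ω` generated by the random variables `X v`, `v ∈ A`. -/
abbrev sigmaOf (X : ∀ v, Ω → E v) (A : Set V) : MeasurableSpace Ω :=
  ⨆ v ∈ A, MeasurableSpace.comap (X v) inferInstance

theorem sigmaOf_le [mΩ : MeasurableSpace Ω] {X : ∀ v, Ω → E v} (hX : ∀ v, Measurable (X v))
    (A : Set V) : sigmaOf X A ≤ mΩ :=
  iSup₂_le fun v _ => (hX v).comap_le

variable [MeasurableSpace Ω] [StandardBorelSpace Ω]

/-- The variables in `A` and the variables in `B` are conditionally independent given the
variables in `C`. -/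
def CondIndepVars (μ : Measure Ω) [IsFiniteMeasure μ] (X : ∀ v, Ω → E v)
    (hX : ∀ v, Measurable (X v)) (A B C : Set V) : Prop :=
  CondIndep (sigmaOf X C) (sigmaOf X A) (sigmaOf X B) (sigmaOf_le hX C) μ

/-- The Markov condition: the joint law of the variables factorizes as the product of the
conditional laws of each variable given its parents. It is expressed, for arbitrary (discrete,
continuous or mixed) variables, by saying that each variable is conditionally independent of its
non-descendants given its parents. -/
def IsMarkov (G : Digraph V) (μ : Measure Ω) [IsFiniteMeasure μ] (X : ∀ v, Ω → E v)
    (hX : ∀ v, Measurable (X v)) : Prop :=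
  ∀ v, CondIndepVars μ X hX {v} (nonDescendants G v \ parents G v) (parents G v)

/-- Faithfulness: every conditional independence among disjoint sets of variables is displayed by
the graph as a d-separation. -/
def IsFaithful (G : Digraph V) (μ : Measure Ω) [IsFiniteMeasure μ] (X : ∀ v, Ω → E v)
    (hX : ∀ v, Measurable (X v)) : Prop :=
  ∀ A B C : Set V, Disjoint A B → Disjoint A C → Disjoint B C →
    CondIndepVars μ X hX A B C → DSep G A B C

end Probability

/-! ## The improved IAMB algorithm

`I i j Z` is the computed value of the conditional mutual information of node `i` and node `j`
given the set of nodes `Z`; the value `+∞` is allowed. -/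

section Algorithm

variable {n : ℕ}

/-- What the pseudocode leaves open: which maximizer is found when there are ties, and the orders
in which the loops over the elements of a candidate blanket run through it. -/
structure Choices (I : Fin n → Fin n → Finset (Fin n) → EReal) where
  /-- the node found for the target `i` among the candidates `S`, given `C` -/
  argmax : Fin n → Finset (Fin n) → Finset (Fin n) → Fin n
  argmax_mem : ∀ i S C, S.Nonempty → argmax i S C ∈ S
  le_argmax : ∀ i S C, ∀ j ∈ S, I i j C ≤ I i (argmax i S C) C
  /-- the order of the backward loop for node `i` -/
  backwardOrder : Fin n → Finset (Fin n) → List (Fin n)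
  backwardOrder_nodup : ∀ i C, (backwardOrder i C).Nodup
  mem_backwardOrder : ∀ i C j, j ∈ backwardOrder i C ↔ j ∈ C
  /-- the order of the symmetry-check loop for node `i` -/
  checkOrder : Fin n → Finset (Fin n) → List (Fin n)
  checkOrder_nodup : ∀ i C, (checkOrder i C).Nodup
  mem_checkOrder : ∀ i C j, j ∈ checkOrder i C ↔ j ∈ C

theorem Choices.nonempty (I : Fin n → Fin n → Finset (Fin n) → EReal) : Nonempty (Choices I) := by
  have h : ∀ (i : Fin n) (S C : Finset (Fin n)), ∃ j : Fin n,
      (S.Nonempty → j ∈ S) ∧ ∀ k ∈ S, I i k C ≤ I i j C := by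
    intro i S C
    rcases S.eq_empty_or_nonempty with rfl | hS
    · exact ⟨i, by simp, by simp⟩
    · obtain ⟨j, hj, hmax⟩ := S.exists_max_image (fun k => I i k C) hS
      exact ⟨j, fun _ => hj, hmax⟩
  choose f hf hmax using h
  exact ⟨⟨f, hf, hmax, fun _ C => C.toList, fun _ C => C.nodup_toList, by simp,
    fun _ C => C.toList, fun _ C => C.nodup_toList, by simp⟩⟩

variable {I : Fin n → Fin n → Finset (Fin n) → EReal}

/-- Forward phase for node `i`, from the remaining nodes `S` and the current candidate blanket `C`:
find a node `j ≠ i` in `S` that maximizes the conditional mutual information with `i` given `C`;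
if the maximum exceeds `α`, move `j` from `S` to `C` and repeat, otherwise (or if there is no node
left) stop. -/
noncomputable def forward (ch : Choices I) (α : ℝ) (i : Fin n) (S C : Finset (Fin n)) :
    Finset (Fin n) :=
  if _hS : (S.erase i).Nonempty then
    if (α : EReal) < I i (ch.argmax i (S.erase i) C) C then
      forward ch α i (S.erase (ch.argmax i (S.erase i) C))
        (insert (ch.argmax i (S.erase i) C) C)
    else C
  else C
termination_by S.card
decreasing_by
  exact Finset.card_erase_lt_of_mem (Finset.mem_of_mem_erase (ch.argmax_mem _ _ _ _hS))

/-- Backward phase for node `i`: run once through the nodes `k` of the candidate blanket, removing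
`k` from the current candidate blanket `D` if the conditional mutual information of `i` and `k`
given `D \ {k}` is below `α`. -/
noncomputable def backward (ch : Choices I) (α : ℝ) (i : Fin n) (C : Finset (Fin n)) :
    Finset (Fin n) :=
  (ch.backwardOrder i C).foldl
    (fun D k => if I i k (D.erase k) < (α : EReal) then D.erase k else D) C

/-- Symmetry check of the candidate blanket of node `i`: run through its nodes `j`, removing `j` if
`i` is not in the current candidate blanket of `j`. -/
def checkNode (ch : Choices I) (M : Fin n → Finset (Fin n)) (i : Fin n) :
    Fin n → Finset (Fin n) :=
  (ch.checkOrder i (M i)).foldl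
    (fun M j => if i ∈ M j then M else Function.update M i ((M i).erase j)) M

/-- The improved IAMB algorithm with threshold `α`: for every node the forward phase, started from
the empty set, and the backward phase; then the symmetry check of the nodes `1, …, n` in turn. -/
noncomputable def improvedIAMB (ch : Choices I) (α : ℝ) : Fin n → Finset (Fin n) :=
  (List.finRange n).foldl (checkNode ch)
    (fun i => backward ch α i (forward ch α i Finset.univ ∅))

end Algorithm

end ImprovedIAMB

-- There are finitely many values of `I`, so below the least positive one every threshold turns the
-- test into an exact test of conditional independence (`exists_threshold`). Two facts about these
-- independences suffice. By the Markov condition, any set that contains the blanket of `i`, but not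
-- `i`, screens `i` off from every node outside it (`condIndepVars_blanketWithin`). The proof is an
-- induction on ancestral sets that uses only the semigraphoid rules; the intersection property,
-- which can fail without positivity, is not needed. By faithfulness, a neighbour of `i` depends on
-- `i` given any set avoiding both, and a spouse does so once the children of `i` are in the
-- conditioning set (`not_dSep_of_mem_markovBlanket`). Whatever choices were made, when the forward
-- phase stops it has collected all children, hence the whole blanket. The backward phase keeps the
-- blanket inside the current set, so each of its tests decides membership in the blanket correctly.
-- Blankets being symmetric, the symmetry check changes nothing.

namespace ImprovedIAMB

-- Conditional independence through conditional probabilities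

section CondIndep

variable {Ω : Type*} {mΩ : MeasurableSpace Ω} {μ : Measure Ω}
/-- Pulling a set of the conditioning σ-algebra out of a conditional probability. -/
theorem condExp_inter_ae_eq_indicator [IsFiniteMeasure μ] {m : MeasurableSpace Ω} {s t : Set Ω}
    (hs : MeasurableSet[m] s) (ht : MeasurableSet[mΩ] t) :
    μ⟦t ∩ s | m⟧ =ᵐ[μ] s.indicator (μ⟦t | m⟧) := by
  have h := condExp_indicator (m := m) (μ := μ) (f := t.indicator fun _ => (1 : ℝ))
    ((integrable_const 1).indicator ht) hs
  rwa [Set.indicator_indicator, Set.inter_comm] at h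

/-- Conditional expectation given `m` of the restriction to `s` of an `m`-measurable function. -/
theorem condExp_indicator_condExp [IsFiniteMeasure μ] {m : MeasurableSpace Ω} {s t : Set Ω} (hs : MeasurableSet[mΩ] s) :
    μ[s.indicator (μ⟦t | m⟧) | m] =ᵐ[μ] μ⟦t | m⟧ * μ⟦s | m⟧ := by
  have e : s.indicator (μ⟦t | m⟧) = μ⟦t | m⟧ * s.indicator fun _ => (1 : ℝ) := by
    ext ω
    by_cases h : ω ∈ s <;> simp [h]
  have hint : Integrable (s.indicator (μ⟦t | m⟧)) μ := integrable_condExp.indicator hs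
  rw [e] at hint ⊢
  exact condExp_mul_of_stronglyMeasurable_left stronglyMeasurable_condExp hint
    ((integrable_const 1).indicator hs)

theorem generateFrom_image2_inter (m₁ m₂ : MeasurableSpace Ω) :
    m₁ ⊔ m₂ = MeasurableSpace.generateFrom
      (Set.image2 (· ∩ ·) {s | MeasurableSet[m₁] s} {s | MeasurableSet[m₂] s}) := by
  apply le_antisymm
  · refine sup_le (fun s hs => ?_) (fun s hs => ?_)
    · exact MeasurableSpace.measurableSet_generateFrom
        ⟨s, hs, Set.univ, MeasurableSet.univ, Set.inter_univ s⟩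
    · exact MeasurableSpace.measurableSet_generateFrom
        ⟨Set.univ, MeasurableSet.univ, s, hs, Set.univ_inter s⟩
  · refine MeasurableSpace.generateFrom_le ?_
    rintro _ ⟨s, hs, t, ht, rfl⟩
    exact MeasurableSet.inter (le_sup_left (a := m₁) (b := m₂) s hs)
      (le_sup_right (a := m₁) (b := m₂) t ht)

theorem isPiSystem_image2_inter (m₁ m₂ : MeasurableSpace Ω) :
    IsPiSystem (Set.image2 (· ∩ ·) {s | MeasurableSet[m₁] s} {s | MeasurableSet[m₂] s}) := by
  rintro _ ⟨s, hs, t, ht, rfl⟩ _ ⟨s', hs', t', ht', rfl⟩ _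
  exact ⟨s ∩ s', MeasurableSet.inter hs hs', t ∩ t', MeasurableSet.inter ht ht',
    Set.inter_inter_inter_comm s s' t t'⟩

/-- Two integrable functions with the same integrals over a π-system that generates `m` and over
the whole space have the same integrals over all `m`-measurable sets. -/
theorem setIntegral_eq_of_piSystem {m : MeasurableSpace Ω} (hm : m ≤ mΩ) {S : Set (Set Ω)}
    (hS : IsPiSystem S) (hgen : m = MeasurableSpace.generateFrom S) {f g : Ω → ℝ}
    (hf : Integrable f μ) (hg : Integrable g μ) (huniv : ∫ ω, f ω ∂μ = ∫ ω, g ω ∂μ)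
    (hSeq : ∀ s ∈ S, ∫ ω in s, f ω ∂μ = ∫ ω in s, g ω ∂μ) {s : Set Ω} (hs : MeasurableSet[m] s) :
    ∫ ω in s, f ω ∂μ = ∫ ω in s, g ω ∂μ := by
  induction s, hs using MeasurableSpace.induction_on_inter hgen hS with
  | empty => simp
  | basic t ht => exact hSeq t ht
  | compl t ht h =>
    have hf' := integral_add_compl (hm t ht) hf
    have hg' := integral_add_compl (hm t ht) hg
    linarith
  | iUnion t hd ht h =>
    rw [integral_iUnion (fun k => hm _ (ht k)) hd hf.integrableOn,
      integral_iUnion (fun k => hm _ (ht k)) hd hg.integrableOn]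
    exact tsum_congr h

/-- `m₁` and `m₂` are conditionally independent given `m'` if and only if, for the sets of `m₁`,
conditioning on `m₂ ⊔ m'` is the same as conditioning on `m'`. -/
theorem condIndep_iff_condExp_sup [IsFiniteMeasure μ] [StandardBorelSpace Ω] {m' m₁ m₂ : MeasurableSpace Ω}
    (hm' : m' ≤ mΩ) (hm₁ : m₁ ≤ mΩ) (hm₂ : m₂ ≤ mΩ) :
    CondIndep m' m₁ m₂ hm' μ ↔
      ∀ t, MeasurableSet[m₁] t → μ⟦t | m₂ ⊔ m'⟧ =ᵐ[μ] μ⟦t | m'⟧ := by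
  have hsup : m₂ ⊔ m' ≤ mΩ := sup_le hm₂ hm'
  rw [condIndep_iff m' m₁ m₂ hm' hm₁ hm₂ μ]
  constructor
  · intro h t ht
    have htint : Integrable (t.indicator fun _ => (1 : ℝ)) μ :=
      (integrable_const 1).indicator (hm₁ t ht)
    refine (ae_eq_condExp_of_forall_setIntegral_eq hsup htint
      (fun _ _ _ => integrable_condExp.integrableOn) (fun s hs _ => ?_)
      (stronglyMeasurable_condExp.mono le_sup_right).aestronglyMeasurable).symm
    -- It suffices to integrate over `s ∩ u` with `s` in `m₂` and `u` in `m'`. Over `u`, both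
    -- integrands may be replaced by their conditional expectations given `m'`, which agree by the
    -- product formula.
    refine setIntegral_eq_of_piSystem hsup (isPiSystem_image2_inter m₂ m')
      (generateFrom_image2_inter m₂ m') integrable_condExp htint (integral_condExp hm') ?_ hs
    rintro _ ⟨s, hs, u, hu, rfl⟩
    have hs' : MeasurableSet[mΩ] s := hm₂ s hs
    have hu' : MeasurableSet[mΩ] u := hm' u hu
    change ∫ ω in s ∩ u, _ ∂μ = ∫ ω in s ∩ u, _ ∂μ
    rw [Set.inter_comm, ← setIntegral_indicator hs', ← setIntegral_indicator hs',
      Set.indicator_indicator, Set.inter_comm s t,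
      ← setIntegral_condExp hm' (integrable_condExp.indicator hs') hu,
      ← setIntegral_condExp (f := (t ∩ s).indicator fun _ => (1 : ℝ)) hm'
        ((integrable_const 1).indicator ((hm₁ t ht).inter hs')) hu]
    refine setIntegral_congr_ae hu' ?_
    filter_upwards [h t s ht hs, condExp_indicator_condExp (μ := μ) (m := m') (t := t) hs']
      with ω h₁ h₂ _
    rw [h₁, h₂]
  · intro h t s ht hs
    have h₁ : μ⟦t ∩ s | m₂ ⊔ m'⟧ =ᵐ[μ] s.indicator (μ⟦t | m'⟧) := by
      refine (condExp_inter_ae_eq_indicator (le_sup_left (a := m₂) (b := m') s hs)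
        (hm₁ t ht)).trans ?_
      filter_upwards [h t ht] with ω hω
      simp only [Set.indicator, hω]
    -- Tower property: the conditional probability of `t ∩ s` is computed first given `m₂ ⊔ m'`,
    -- then given `m'`.
    exact ((condExp_condExp_of_le le_sup_right hsup).symm.trans (condExp_congr_ae h₁)).trans
      (condExp_indicator_condExp (hm₂ s hs))

end CondIndep

-- Semigraphoid rules

section Semigraphoid

variable {V Ω : Type*} {E : V → Type*} [∀ v, MeasurableSpace (E v)] {X : ∀ v, Ω → E v}

theorem sigmaOf_mono {A B : Set V} (h : A ⊆ B) : sigmaOf X A ≤ sigmaOf X B :=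
  biSup_mono h

theorem sigmaOf_union (A B : Set V) : sigmaOf X (A ∪ B) = sigmaOf X A ⊔ sigmaOf X B :=
  iSup_union

variable [MeasurableSpace Ω] [StandardBorelSpace Ω] {μ : Measure Ω} [IsFiniteMeasure μ]
  {hX : ∀ v, Measurable (X v)} {A B C D : Set V}

theorem condIndepVars_iff : CondIndepVars μ X hX A B C ↔
    ∀ t, MeasurableSet[sigmaOf X A] t → μ⟦t | sigmaOf X (B ∪ C)⟧ =ᵐ[μ] μ⟦t | sigmaOf X C⟧ := by
  rw [CondIndepVars, condIndep_iff_condExp_sup _ (sigmaOf_le hX A) (sigmaOf_le hX B),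
    sigmaOf_union]

theorem CondIndepVars.symm (h : CondIndepVars μ X hX A B C) : CondIndepVars μ X hX B A C :=
  CondIndep.symm h

/-- Decomposition and weak union. -/
theorem CondIndepVars.weakUnion {B' C' : Set V} (h : CondIndepVars μ X hX A B C)
    (hC : C ⊆ C') (hC' : C' ⊆ B ∪ C) (hB' : B' ⊆ B ∪ C) : CondIndepVars μ X hX A B' C' := by
  rw [condIndepVars_iff] at h ⊢
  -- By the tower property, conditioning on any set between `C` and `B ∪ C` is the same as
  -- conditioning on `C`. This is applied to `B' ∪ C'` and to `C'`.
  have key : ∀ D, C ⊆ D → D ⊆ B ∪ C → ∀ t, MeasurableSet[sigmaOf X A] t →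
      μ⟦t | sigmaOf X D⟧ =ᵐ[μ] μ⟦t | sigmaOf X C⟧ := by
    intro D hCD hD t ht
    refine (condExp_condExp_of_le (sigmaOf_mono hD) (sigmaOf_le hX _)).symm.trans ?_
    refine (condExp_congr_ae (h t ht)).trans ?_
    rw [condExp_of_stronglyMeasurable (sigmaOf_le hX D)
      (stronglyMeasurable_condExp.mono (sigmaOf_mono hCD)) integrable_condExp]
  intro t ht
  exact (key _ (hC.trans Set.subset_union_right) (Set.union_subset hB' hC') t ht).trans
    (key C' hC hC' t ht).symm

theorem CondIndepVars.contraction (h₁ : CondIndepVars μ X hX A B C)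
    (h₂ : CondIndepVars μ X hX A D (B ∪ C)) : CondIndepVars μ X hX A (D ∪ B) C := by
  rw [condIndepVars_iff] at h₁ h₂ ⊢
  intro t ht
  rw [Set.union_assoc]
  exact (h₂ t ht).trans (h₁ t ht)

end Semigraphoid

-- Sinks, blankets within ancestral sets, and active trails

section Graph

variable {V : Type*} {G : Digraph V} {i j : V} {U Z : Set V}

theorem IsDAG.not_adj_self (hG : IsDAG G) (v : V) : ¬ G.Adj v v :=
  fun h => hG v (.single h)

theorem notMem_markovBlanket_self (hG : IsDAG G) : i ∉ markovBlanket G i := by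
  simp [markovBlanket, parents, children, spouses, hG.not_adj_self]

theorem mem_markovBlanket_comm : j ∈ markovBlanket G i ↔ i ∈ markovBlanket G j := by
  simp only [markovBlanket, parents, children, spouses, Set.mem_union, Set.mem_ofPred_eq]
  grind

/-- A set of nodes is ancestral if it contains the parents of its nodes. -/
def IsAncestral (G : Digraph V) (U : Set V) : Prop :=
  ∀ ⦃u v⦄, G.Adj u v → v ∈ U → u ∈ U

/-- `v` is a sink of `U`: a node of `U` without children in `U`. -/
def IsSinkOf (G : Digraph V) (U : Set V) (v : V) : Prop :=
  v ∈ U ∧ ∀ u ∈ U, ¬ G.Adj v u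

theorem IsDAG.exists_isSinkOf [Finite V] (hG : IsDAG G) (hU : U.Nonempty) :
    ∃ v, IsSinkOf G U v := by
  -- The order is reversed, so that minimal elements are sinks.
  let r : V → V → Prop := fun a b => Relation.TransGen G.Adj b a
  have : IsTrans V r := ⟨fun _ _ _ h₁ h₂ => h₂.trans h₁⟩
  have : Std.Irrefl r := ⟨hG⟩
  obtain ⟨v, hv, hmin⟩ := (Finite.wellFounded_of_trans_of_irrefl r).has_min U hU
  exact ⟨v, hv, fun u hu h => hmin u hu (.single h)⟩

theorem IsAncestral.mem_of_reflTransGen (hU : IsAncestral G U) (h : Relation.ReflTransGen G.Adj i j)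
    (hj : j ∈ U) : i ∈ U := by
  induction h using Relation.ReflTransGen.head_induction_on with
  | refl => exact hj
  | head h _ ih => exact hU h ih

theorem IsSinkOf.isAncestral_diff {v : V} (hv : IsSinkOf G U v) (hU : IsAncestral G U) :
    IsAncestral G (U \ {v}) := by
  rintro u w huw ⟨hw, _⟩
  exact ⟨hU huw hw, fun h => hv.2 w hw (h ▸ huw)⟩

theorem IsSinkOf.mem_nonDescendants {v u : V} (hv : IsSinkOf G U v) (hU : IsAncestral G U)
    (hu : u ∈ U) (huv : u ≠ v) : u ∈ nonDescendants G v := by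
  intro h
  rcases Relation.ReflTransGen.cases_head h with rfl | ⟨w, hvw, hwu⟩
  · exact huv rfl
  · exact hv.2 w (hU.mem_of_reflTransGen hwu hu) hvw

/-- The Markov blanket of `i` in the subgraph induced on `U`. -/
def blanketWithin (G : Digraph V) (U : Set V) (i : V) : Set V :=
  {u | u ∈ U ∧ u ≠ i ∧ (G.Adj u i ∨ G.Adj i u ∨ ∃ c ∈ U, G.Adj i c ∧ G.Adj u c)}

theorem blanketWithin_univ (hG : IsDAG G) : blanketWithin G Set.univ i = markovBlanket G i := by
  ext u
  have := hG.not_adj_self i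
  simp only [blanketWithin, markovBlanket, parents, children, spouses, Set.mem_union,
    Set.mem_ofPred_eq, Set.mem_univ, true_and]
  grind

theorem IsSinkOf.blanketWithin_eq (hG : IsDAG G) (hi : IsSinkOf G U i) (hU : IsAncestral G U) :
    blanketWithin G U i = parents G i := by
  ext u
  have := hG.not_adj_self i
  have := @hU u i
  have := hi.1
  have := hi.2
  simp only [blanketWithin, parents, Set.mem_ofPred_eq]
  grind

/-- Besides itself, the child `v` contributes its other parents, as spouses of `i`; being a sink, it
contributes in no other way. -/
theorem IsSinkOf.blanketWithin_of_adj {v : V} (hG : IsDAG G) (hv : IsSinkOf G U v)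
    (hU : IsAncestral G U) (h : G.Adj i v) :
    blanketWithin G U i = {v} ∪ (blanketWithin G (U \ {v}) i ∪ (parents G v \ {i})) := by
  ext u
  have := hG.not_adj_self
  have := @hU u v
  have := hv.1
  have := hv.2
  simp only [blanketWithin, parents, Set.mem_ofPred_eq, Set.mem_union, Set.mem_sdiff,
    Set.mem_singleton_iff]
  grind

theorem IsSinkOf.blanketWithin_of_not_adj {v : V} (hv : IsSinkOf G U v) (hi : i ∈ U)
    (h : ¬ G.Adj i v) : blanketWithin G U i = blanketWithin G (U \ {v}) i := by
  ext u
  have := hv.2 i hi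
  have := hv.2
  simp only [blanketWithin, Set.mem_ofPred_eq, Set.mem_sdiff, Set.mem_singleton_iff]
  grind

/-- A trail of one edge has no interior position, hence no collider. -/
theorem not_dSep_of_adj (h : G.Adj i j ∨ G.Adj j i) (hi : i ∉ Z) (hj : j ∉ Z) :
    ¬ DSep G {i} {j} Z := by
  intro hd
  refine hd 1 (fun k => if k = 0 then i else j) (by simp) (by simp) (fun k hk => ?_)
    (fun k hk => ?_)
  · obtain rfl : k = 0 := by omega
    simpa using h
  · have hc : ¬ IsCollider G 1 (fun k => if k = 0 then i else j) k := fun hc => by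
      have h₁ := hc.1
      have h₂ := hc.2.1
      omega
    refine ⟨fun h' => absurd h' hc, fun _ => ?_⟩
    dsimp only
    split_ifs <;> assumption

theorem not_dSep_of_common_child {c : V} (hic : G.Adj i c) (hjc : G.Adj j c) (hi : i ∉ Z)
    (hj : j ∉ Z) (hc : c ∈ Z) : ¬ DSep G {i} {j} Z := by
  intro hd
  refine hd 2 (fun k => if k = 0 then i else if k = 1 then c else j) (by simp) (by simp)
    (fun k hk => ?_) (fun k hk => ?_)
  · interval_cases k <;> simp [hic, hjc]
  · interval_cases k <;> simp [IsCollider, hic, hjc, hi, hj, hc]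

/-- A node of the Markov blanket of `i` that is not a child is d-connected with `i` given any set
that contains the children of `i`; a child is d-connected with `i` given any set. -/
theorem not_dSep_of_mem_markovBlanket (hj : j ∈ markovBlanket G i) (hiZ : i ∉ Z)
    (hjZ : j ∉ Z) (hch : j ∉ children G i → children G i ⊆ Z) : ¬ DSep G {i} {j} Z := by
  rcases hj with (hj | hj) | ⟨-, c, hic, hjc⟩
  · exact not_dSep_of_adj (.inr hj) hiZ hjZ
  · exact not_dSep_of_adj (.inl hj) hiZ hjZ
  · by_cases hij : j ∈ children G i
    · exact not_dSep_of_adj (.inl hij) hiZ hjZ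
    · exact not_dSep_of_common_child hic hjc hiZ hjZ (hch hij hic)

end Graph

-- Markov blankets and conditional independence

section MarkovBlanket

variable {V Ω : Type*} {E : V → Type*} [∀ v, MeasurableSpace (E v)] {X : ∀ v, Ω → E v}
  [MeasurableSpace Ω] [StandardBorelSpace Ω] {μ : Measure Ω} [IsFiniteMeasure μ]
  {hX : ∀ v, Measurable (X v)} {G : Digraph V} {i j : V} {U Z : Set V}

/-- A sink of an ancestral set is independent of the other nodes of the set given its parents. -/
theorem IsMarkov.condIndepVars_of_isSinkOf (hM : IsMarkov G μ X hX) {v : V}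
    (hv : IsSinkOf G U v) (hU : IsAncestral G U) :
    CondIndepVars μ X hX {v} (U \ {v}) (parents G v) := by
  refine (hM v).weakUnion subset_rfl Set.subset_union_right ?_
  rw [Set.sdiff_union_self]
  exact fun u hu => .inl (hv.mem_nonDescendants hU hu.1 hu.2)

/-- Induction on `U`, deleting a sink `v ≠ i`, which is independent of the rest of `U` given its
parents. If there is no such sink, then `i` is itself a sink and its blanket within `U` is its set
of parents. -/
theorem IsMarkov.condIndepVars_blanketWithin [Finite V] (hG : IsDAG G) (hM : IsMarkov G μ X hX)
    (hU : IsAncestral G U) (hi : i ∈ U) :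
    CondIndepVars μ X hX {i} (U \ {i}) (blanketWithin G U i) := by
  induction U using WellFoundedLT.induction with
  | _ U ih =>
  by_cases hex : ∃ v, v ≠ i ∧ IsSinkOf G U v
  · obtain ⟨v, hvi, hv⟩ := hex
    have h₁ := ih (U \ {v}) (Set.sdiff_singleton_ssubset.mpr hv.1) (hv.isAncestral_diff hU)
      ⟨hi, hvi.symm⟩
    have h₂ := hM.condIndepVars_of_isSinkOf hv hU
    have hvv := hG.not_adj_self v
    have hsub : blanketWithin G (U \ {v}) i ⊆ (U \ {v}) \ {i} := fun u hu => ⟨hu.1, hu.2.1⟩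
    have hpa : parents G v ⊆ U \ {v} := fun u hu => ⟨hU hu hv.1, fun h => hvv (h ▸ hu)⟩
    by_cases hadj : G.Adj i v
    · rw [hv.blanketWithin_of_adj hG hU hadj]
      set W := blanketWithin G (U \ {v}) i ∪ (parents G v \ {i}) with hW
      have hWsub : W ⊆ (U \ {v}) \ {i} :=
        Set.union_subset hsub (Set.sdiff_subset_sdiff_left hpa)
      have h₃ : CondIndepVars μ X hX {i} ((U \ {v}) \ {i}) W :=
        h₁.weakUnion Set.subset_union_left (hWsub.trans Set.subset_union_left)
          Set.subset_union_left
      have h₄ : CondIndepVars μ X hX {v} ((U \ {v}) \ {i}) ({i} ∪ W) := by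
        refine h₂.weakUnion (fun u hu => ?_) (fun u hu => .inl ?_) (fun u hu => .inl hu.1)
        · by_cases hui : u = i
          · exact .inl hui
          · exact .inr (.inr ⟨hu, hui⟩)
        · rcases hu with rfl | hu
          · exact ⟨hi, hvi.symm⟩
          · exact (hWsub hu).1
      -- Contraction of `h₃` and `h₄` makes the remaining nodes independent of `i` and `v` jointly
      -- given `W`; weak union then moves `v` into the condition.
      have h₅ : CondIndepVars μ X hX {i} ((U \ {v}) \ {i}) ({v} ∪ W) :=
        ((h₃.symm.contraction h₄.symm).weakUnion Set.subset_union_right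
          (Set.union_subset_union_left _ Set.subset_union_left)
          (Set.subset_union_right.trans Set.subset_union_left)).symm
      refine h₅.weakUnion subset_rfl Set.subset_union_right (fun u hu => ?_)
      by_cases huv : u = v
      · exact .inr (.inl huv)
      · exact .inl ⟨⟨hu.1, huv⟩, hu.2⟩
    · rw [hv.blanketWithin_of_not_adj hi hadj]
      -- As `i` is not a parent of `v`, it can stay out of the condition; contraction then adds `v`
      -- to the nodes screened off from `i`.
      have h₃ : CondIndepVars μ X hX {v} {i}
          (((U \ {v}) \ {i}) ∪ blanketWithin G (U \ {v}) i) := by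
        rw [Set.union_eq_self_of_subset_right hsub]
        refine h₂.weakUnion (fun u hu => ⟨hpa hu, ?_⟩) (fun u hu => .inl hu.1) ?_
        · rintro rfl
          exact hadj hu
        · rintro u rfl
          exact .inl ⟨hi, hvi.symm⟩
      refine (h₁.contraction h₃.symm).weakUnion subset_rfl Set.subset_union_right
        (fun u hu => .inl ?_)
      by_cases huv : u = v
      · exact .inl huv
      · exact .inr ⟨⟨hu.1, huv⟩, hu.2⟩
  · obtain ⟨v, hv⟩ := hG.exists_isSinkOf ⟨i, hi⟩
    obtain rfl : v = i := by
      by_contra h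
      exact hex ⟨v, h, hv⟩
    rw [hv.blanketWithin_eq hG hU]
    exact hM.condIndepVars_of_isSinkOf hv hU

/-- Given a set that contains its Markov blanket, a node is independent of every node outside. -/
theorem IsMarkov.condIndepVars_of_markovBlanket_subset [Finite V] (hG : IsDAG G)
    (hM : IsMarkov G μ X hX) (hZ : markovBlanket G i ⊆ Z) (hi : i ∉ Z) (hij : i ≠ j) :
    CondIndepVars μ X hX {i} {j} Z := by
  have h := hM.condIndepVars_blanketWithin hG (U := Set.univ) (fun _ _ _ _ => trivial)
    (Set.mem_univ i)
  rw [blanketWithin_univ hG] at h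
  refine h.weakUnion hZ (fun u hu => .inl ⟨trivial, ?_⟩) ?_
  · rintro rfl
    exact hi hu
  · rintro u rfl
    exact .inl ⟨trivial, hij.symm⟩

theorem IsFaithful.not_condIndepVars (hF : IsFaithful G μ X hX) (hij : i ≠ j)
    (hj : j ∈ markovBlanket G i) (hiZ : i ∉ Z) (hjZ : j ∉ Z) (hch : j ∉ children G i → children G i ⊆ Z) :
    ¬ CondIndepVars μ X hX {i} {j} Z := fun h =>
  not_dSep_of_mem_markovBlanket hj hiZ hjZ hch <|
    hF _ _ _ (Set.disjoint_singleton.mpr hij) (Set.disjoint_singleton_left.mpr hiZ)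
      (Set.disjoint_singleton_left.mpr hjZ) h

end MarkovBlanket

-- Correctness of the phases of the algorithm

section Algorithm

variable {n : ℕ} {I : Fin n → Fin n → Finset (Fin n) → EReal}

/-- For every small enough threshold, the positive values of `I` are exactly those above it. -/
theorem exists_threshold (I : Fin n → Fin n → Finset (Fin n) → EReal) :
    ∃ α₀ : ℝ, 0 < α₀ ∧ ∀ α : ℝ, 0 < α → α < α₀ → ∀ i j Z, 0 < I i j Z → (α : EReal) < I i j Z := by
  have h : ∀ᶠ α : ℝ in nhdsWithin 0 (Set.Ioi 0),
      ∀ i j Z, 0 < I i j Z → (α : EReal) < I i j Z := by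
    simp only [Filter.eventually_all]
    intro i j Z hpos
    have ht : Filter.Tendsto (fun α : ℝ => (α : EReal)) (nhds 0) (nhds 0) :=
      continuous_coe_real_ereal.tendsto 0
    exact (ht.eventually_lt_const hpos).filter_mono nhdsWithin_le_nhds
  obtain ⟨α₀, hα₀, hsub⟩ := mem_nhdsGT_iff_exists_Ioo_subset.mp h
  exact ⟨α₀, hα₀, fun α h₀ h₁ => hsub ⟨h₀, h₁⟩⟩

/-- The forward phase ends with a set without the target, outside of which no node has conditional
mutual information above the threshold. -/
theorem forward_spec (ch : Choices I) (α : ℝ) (i : Fin n) (S C : Finset (Fin n)) (hi : i ∉ C)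
    (hSC : ∀ j ∉ C, j ∈ S) :
    i ∉ forward ch α i S C ∧
      ∀ j, j ≠ i → j ∉ forward ch α i S C → I i j (forward ch α i S C) ≤ α := by
  fun_induction forward ch α i S C with
  | case1 S C hS hlt ih =>
    have hmem := ch.argmax_mem i (S.erase i) C hS
    refine ih ?_ fun j hj => ?_
    · rw [Finset.mem_insert, not_or]
      exact ⟨(Finset.ne_of_mem_erase hmem).symm, hi⟩
    · rw [Finset.mem_insert, not_or] at hj
      exact Finset.mem_erase.mpr ⟨hj.1, hSC j hj.2⟩
  | case2 S C hS hlt =>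
    exact ⟨hi, fun j hji hj => (ch.le_argmax i (S.erase i) C j
      (Finset.mem_erase.mpr ⟨hji, hSC j hj⟩)).trans (not_lt.mp hlt)⟩
  | case3 S C hS =>
    exact ⟨hi, fun j hji hj => absurd ⟨j, Finset.mem_erase.mpr ⟨hji, hSC j hj⟩⟩ hS⟩

/-- If the elimination test of the backward phase keeps the nodes of `B` and eliminates the others
as long as the current set contains `B`, then the backward phase returns `B`. -/
theorem backward_eq (ch : Choices I) (α : ℝ) {i : Fin n} {B : Set (Fin n)} {C : Finset (Fin n)}
    (hBC : B ⊆ C) (hiC : i ∉ C)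
    (hkeep : ∀ D : Finset (Fin n), B ⊆ D → i ∉ D → ∀ k ∈ B, ¬ I i k (D.erase k) < α)
    (hremove : ∀ D : Finset (Fin n), B ⊆ D → i ∉ D → ∀ k ∉ B, k ≠ i → I i k (D.erase k) < α) :
    (backward ch α i C : Set (Fin n)) = B := by
  -- Here `l` is the part of the loop still to be run. An erased node never returns, so one pass
  -- suffices.
  have key : ∀ (l : List (Fin n)) (D : Finset (Fin n)), B ⊆ D → i ∉ D → i ∉ l →
      B ⊆ (l.foldl (fun D k => if I i k (D.erase k) < (α : EReal) then D.erase k else D) D :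
        Finset (Fin n)) ∧
      ∀ k ∈ l.foldl (fun D k => if I i k (D.erase k) < (α : EReal) then D.erase k else D) D,
        k ∈ D ∧ (k ∈ l → k ∈ B) := by
    intro l
    induction l with
    | nil => exact fun D hB _ _ => ⟨hB, fun k hk => ⟨hk, fun h => by simp at h⟩⟩
    | cons a l ih =>
      intro D hB hD hl
      rw [List.mem_cons, not_or] at hl
      rw [List.foldl_cons]
      by_cases ha : a ∈ B
      · rw [if_neg (hkeep D hB hD a ha)]
        obtain ⟨h₁, h₂⟩ := ih D hB hD hl.2
        refine ⟨h₁, fun k hk => ⟨(h₂ k hk).1, fun hkl => ?_⟩⟩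
        rcases List.mem_cons.mp hkl with rfl | hkl
        · exact ha
        · exact (h₂ k hk).2 hkl
      · rw [if_pos (hremove D hB hD a ha (Ne.symm hl.1))]
        have hB' : B ⊆ (D.erase a : Finset (Fin n)) := fun k hk =>
          Finset.mem_coe.mpr (Finset.mem_erase.mpr ⟨fun h => ha (h ▸ hk), hB hk⟩)
        obtain ⟨h₁, h₂⟩ := ih (D.erase a) hB' (fun h => hD (Finset.mem_of_mem_erase h)) hl.2
        refine ⟨h₁, fun k hk => ⟨Finset.mem_of_mem_erase (h₂ k hk).1, fun hkl => ?_⟩⟩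
        rcases List.mem_cons.mp hkl with rfl | hkl
        · exact absurd rfl (Finset.ne_of_mem_erase (h₂ k hk).1)
        · exact (h₂ k hk).2 hkl
  obtain ⟨h₁, h₂⟩ := key (ch.backwardOrder i C) C hBC hiC
    (fun h => hiC ((ch.mem_backwardOrder i C i).mp h))
  exact Set.Subset.antisymm
    (fun k hk => (h₂ k hk).2 ((ch.mem_backwardOrder i C k).mpr (h₂ k hk).1)) h₁

/-- The symmetry check does not change a symmetric family of candidate blankets. -/
theorem checkNode_eq_self (ch : Choices I) {M : Fin n → Finset (Fin n)}
    (hM : ∀ i j, j ∈ M i → i ∈ M j) (i : Fin n) : checkNode ch M i = M := by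
  have key : ∀ l : List (Fin n), (∀ j ∈ l, i ∈ M j) →
      l.foldl (fun M j => if i ∈ M j then M else Function.update M i ((M i).erase j)) M = M := by
    intro l
    induction l with
    | nil => exact fun _ => rfl
    | cons a l ih =>
      intro hl
      rw [List.foldl_cons, if_pos (hl a List.mem_cons_self)]
      exact ih fun j hj => hl j (List.mem_cons_of_mem a hj)
  exact key _ fun j hj => hM i j ((ch.mem_checkOrder i (M i) j).mp hj)

theorem improvedIAMB_of_symm (ch : Choices I) (α : ℝ)
    (h : ∀ i j, j ∈ backward ch α i (forward ch α i Finset.univ ∅) →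
      i ∈ backward ch α j (forward ch α j Finset.univ ∅)) :
    improvedIAMB ch α = fun i => backward ch α i (forward ch α i Finset.univ ∅) :=
  List.foldl_fixed' (checkNode_eq_self ch h) _

end Algorithm

end ImprovedIAMB

theorem mainTheorem8 {n : ℕ} {Ω : Type*} [MeasurableSpace Ω] [StandardBorelSpace Ω]
    (μ : Measure Ω) [IsProbabilityMeasure μ]
    {E : Fin n → Type*} [∀ i, MeasurableSpace (E i)]
    (X : ∀ i, Ω → E i) (hX : ∀ i, Measurable (X i))
    (G : Digraph (Fin n)) (hG : ImprovedIAMB.IsDAG G)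
    (hMarkov : ImprovedIAMB.IsMarkov G μ X hX)
    (hFaithful : ImprovedIAMB.IsFaithful G μ X hX)
    (I : Fin n → Fin n → Finset (Fin n) → EReal)
    (hI_nonneg : ∀ i j Z, i ≠ j → i ∉ Z → j ∉ Z → 0 ≤ I i j Z)
    (hI_zero : ∀ i j Z, i ≠ j → i ∉ Z → j ∉ Z →
      (I i j Z = 0 ↔ ImprovedIAMB.CondIndepVars μ X hX {i} {j} (Z : Set (Fin n)))) :
    ∃ α₀ : ℝ, 0 < α₀ ∧ ∀ α : ℝ, 0 < α → α < α₀ →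
      ∀ (ch : ImprovedIAMB.Choices I) (i : Fin n),
        (ImprovedIAMB.improvedIAMB ch α i : Set (Fin n)) = ImprovedIAMB.markovBlanket G i := by
  open ImprovedIAMB in
  obtain ⟨α₀, hα₀, hthr⟩ := exists_threshold I
  refine ⟨α₀, hα₀, fun α hα hαα₀ ch => ?_⟩
  have hdep : ∀ (i j : Fin n) (Z : Finset (Fin n)), j ∈ markovBlanket G i → i ∉ Z → j ∉ Z →
      (j ∉ children G i → children G i ⊆ Z) → (α : EReal) < I i j Z := by
    intro i j Z hj hi hjZ hch
    have hij : i ≠ j := fun h => notMem_markovBlanket_self hG (h ▸ hj)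
    refine hthr α hα hαα₀ i j Z ((hI_nonneg i j Z hij hi hjZ).lt_of_ne' fun h => ?_)
    exact hFaithful.not_condIndepVars hij hj (mt Finset.mem_coe.mp hi)
      (mt Finset.mem_coe.mp hjZ) hch ((hI_zero i j Z hij hi hjZ).mp h)
  have hphases : ∀ i, (backward ch α i (forward ch α i Finset.univ ∅) : Set (Fin n)) =
      markovBlanket G i := by
    intro i
    obtain ⟨hiF, hF⟩ := forward_spec ch α i Finset.univ ∅ (Finset.notMem_empty i)
      (fun j _ => Finset.mem_univ j)
    set F := forward ch α i Finset.univ ∅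
    have hmem : ∀ j ∈ markovBlanket G i, (j ∉ children G i → children G i ⊆ F) → j ∈ F := by
      intro j hj hch
      by_contra hjF
      refine (hF j ?_ hjF).not_gt (hdep i j F hj hiF hjF hch)
      rintro rfl
      exact notMem_markovBlanket_self hG hj
    -- Children come first because their dependence on `i` needs no assumption on the conditioning
    -- set; they then force in the spouses.
    have hchF : children G i ⊆ F := fun j hj => hmem j (.inl (.inr hj)) (absurd hj)
    refine backward_eq ch α (fun j hj => hmem j hj fun _ => hchF) hiF (fun D hD hiD k hk => ?_)
      (fun D hD hiD k hk hki => ?_)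
    -- If `k` is not a child of `i`, erasing `k` leaves all children of `i` in the conditioning set.
    · refine (hdep i k _ hk (fun h => hiD (Finset.mem_of_mem_erase h))
        (Finset.notMem_erase k D) fun hkc j hj => ?_).not_gt
      exact Finset.mem_coe.mpr (Finset.mem_erase.mpr
        ⟨fun h => hkc (h ▸ hj), hD (.inl (.inr hj))⟩)
    · have hi' : i ∉ D.erase k := fun h => hiD (Finset.mem_of_mem_erase h)
      rw [(hI_zero i k _ hki.symm hi' (Finset.notMem_erase k D)).mpr
        (hMarkov.condIndepVars_of_markovBlanket_subset hG (fun j hj => ?_)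
          (mt Finset.mem_coe.mp hi') hki.symm)]
      · exact_mod_cast hα
      · exact Finset.mem_coe.mpr (Finset.mem_erase.mpr ⟨fun h => hk (h ▸ hj), hD hj⟩)
  rw [improvedIAMB_of_symm ch α fun i j hj => ?_]
  · exact hphases
  · rw [← Finset.mem_coe, hphases] at hj ⊢
    exact mem_markovBlanket_comm.mp hj
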